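/- Let $\varphi:\mathcal X\times\mathcal X\to\mathbb R$ be a positive semi-definite kernel, $x_1,\dots,x_n\in\mathcal X$ ($n\ge 1$) points with $\varphi(x_i,x_i)>0$, and let $G\in\mathbb R^{n\times n}$, $G_{ij}=\frac1n\,\varphi(x_i,x_j)/\sqrt{\varphi(x_i,x_i)\varphi(x_j,x_j)}$, be the normalized kernel matrix, with eigenvalues $\lambda_1,\dots,\lambda_n\ge 0$, largest eigenvalue $\lambda_{\max}$ and smallest eigenvalue $\lambda_{\min}$. For real $\alpha>0$, $\alpha\neq 1$, let $$\mathbf S_\alpha(G)=\frac1{1-\alpha}\log_2\Big(\sum_{i=1}^n\lambda_i^\alpha\Big)$$ be the matrix-based Rényi entropy. Let $0<\epsilon<1/3$, $0<\delta<1$, $s=\lceil 8\ln(2/\delta)/\epsilon^2\rceil$, let $g_1,\dots,g_s$ be independent standard Gaussian vectors in $\mathbb R^n$, and let $$\tilde{\mathbf S}_\alpha(G)=\frac1{1-\alpha}\log_2\Big(\frac{\lambda_{\max}^\alpha}{s}\sum_{i=1}^s\sum_{k=0}^m\binom{\alpha}{k}\,g_i^\top\Big(\frac{G}{\lambda_{\max}}-I\Big)^k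 g_i\Big)$$ be the Taylor-series estimator of degree $$m=\Bigg\lceil\alpha+\begin{cases}W_0\Big(\kappa\beta\big(\tfrac{\Gamma(\alpha+1)}{\epsilon\pi}\big)^{1/(\alpha+1)}\Big)\Big/\beta & \text{if }\lambda_{\min}>0,\\[1ex]\big(\tfrac{n\,c_\alpha}{\epsilon\pi}\big)^{1/\alpha}&\text{if }\lambda_{\min}=0,\end{cases}\Bigg\rceil$$ where $\kappa=\lambda_{\max}/\lambda_{\min}$, $\beta=-\ln(1-1/\kappa)/(\alpha+1)$, $W_0$ is the principal branch of the Lambert $W$ function (the quotient $W_0(\cdot)/\beta$ is read as its limit $0$ when $\kappa=1$), and $c_\alpha=\Gamma(\alpha+1)$ if $\alpha\ge\frac12$, $c_\alpha=\Gamma(\alpha)$ if $\alpha<\frac12$. Then with probability at least $1-\delta$, $$\big|\mathbf S_\alpha(G)-\tilde{\mathbf S}_\alpha(G)\big|\le\Big|\frac1{1-\alpha}\log_2(1-3\epsilon)\Big|.$$ -/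

import Mathlib

open MeasureTheory ProbabilityTheory Matrix

noncomputable section

namespace RenyiTaylor

/-- A real-valued positive (semi-definite) kernel: every finite Gram matrix is symmetric positive
semi-definite. -/
def IsPositiveKernel {X : Type*} (φ : X → X → ℝ) : Prop :=
  ∀ (k : ℕ) (y : Fin k → X), (Matrix.of fun i j => φ (y i) (y j)).PosSemidef

/-- The normalized kernel matrix `G i j = (1/n) * K i j / √(K i i * K j j)`, `K i j = φ (x i) (x j)`. -/
def kernelMatrix {X : Type*} {n : ℕ} (φ : X → X → ℝ) (x : Fin n → X) :
    Matrix (Fin n) (Fin n) ℝ :=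
  Matrix.of fun i j => 1 / (n : ℝ) * (φ (x i) (x j) / √(φ (x i) (x i) * φ (x j) (x j)))

theorem kernelMatrix_isHermitian {X : Type*} {n : ℕ} {φ : X → X → ℝ} (hφ : IsPositiveKernel φ)
    (x : Fin n → X) : (kernelMatrix φ x).IsHermitian := by
  have h := (hφ n x).isHermitian
  ext i j
  have hij : φ (x j) (x i) = φ (x i) (x j) := by simpa using h.apply i j
  simp [kernelMatrix, hij, mul_comm]

variable {n : ℕ} {G : Matrix (Fin n) (Fin n) ℝ}

/-- The largest eigenvalue of a real symmetric matrix. -/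
def lambdaMax (hG : G.IsHermitian) : ℝ := ⨆ i, hG.eigenvalues i

/-- The smallest eigenvalue of a real symmetric matrix. -/
def lambdaMin (hG : G.IsHermitian) : ℝ := ⨅ i, hG.eigenvalues i

/-- The condition number `λ_max / λ_min` (only used when `λ_min > 0`). -/
def condNumber (hG : G.IsHermitian) : ℝ := lambdaMax hG / lambdaMin hG

/-- The matrix-based Rényi entropy `(1/(1-α)) log₂ (∑ᵢ λᵢ(G)^α)`. -/
def renyiEntropy (hG : G.IsHermitian) (α : ℝ) : ℝ :=
  1 / (1 - α) * Real.logb 2 (∑ i, hG.eigenvalues i ^ α)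

/-- The output of the Taylor-series estimator of degree `m` on the query vectors `g 0, …, g (s-1)`. -/
def taylorEstimate (hG : G.IsHermitian) (α : ℝ) (m : ℕ) {s : ℕ}
    (g : Fin s → EuclideanSpace ℝ (Fin n)) : ℝ :=
  1 / (1 - α) * Real.logb 2 (lambdaMax hG ^ α / s *
    ∑ i, ∑ k ∈ Finset.range (m + 1),
      Ring.choose α k * ((g i).ofLp ⬝ᵥ (((lambdaMax hG)⁻¹ • G - 1) ^ k *ᵥ (g i).ofLp)))

/-- The principal branch of the Lambert `W` function on `[-1/e, ∞)`: the solution `w ≥ -1` of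
`w * exp w = z`. -/
def lambertW0 (z : ℝ) : ℝ :=
  Function.invFunOn (fun w : ℝ => w * Real.exp w) (Set.Ici (-1)) z

/-- The number of random vectors `⌈8 ln(2/δ) / ε²⌉`. -/
def sampleSize (δ ε : ℝ) : ℕ := ⌈8 * Real.log (2 / δ) / ε ^ 2⌉₊

/-- `β = -log(1 - 1/κ) / (α + 1)`. -/
def betaParam (κ α : ℝ) : ℝ := -Real.log (1 - 1 / κ) / (α + 1)

/-- The degree in the full-rank case. For `κ = 1` one has `betaParam 1 α = 0` in Lean, so that the
quotient is `0`; this is also its limit as `κ → 1`. -/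
def fullRankDegree (κ α ε : ℝ) : ℕ :=
  ⌈α + lambertW0 (κ * betaParam κ α * (Real.Gamma (α + 1) / (ε * Real.pi)) ^ (1 / (α + 1)))
      / betaParam κ α⌉₊

/-- The Gamma factor in the rank-deficient degree. -/
def gammaFactor (α : ℝ) : ℝ :=
  if α < 1 / 2 then Real.Gamma α else Real.Gamma (α + 1)

/-- The degree in the rank-deficient case. -/
def rankDeficientDegree (n : ℕ) (α ε : ℝ) : ℕ :=
  ⌈α + (n * gammaFactor α / (ε * Real.pi)) ^ (1 / α)⌉₊

/-- The degree of the Taylor polynomial, according to whether `λ_min > 0` or `λ_min = 0`. -/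
def taylorDegree (hG : G.IsHermitian) (α ε : ℝ) : ℕ :=
  if 0 < lambdaMin hG then fullRankDegree (condNumber hG) α ε else rankDeficientDegree n α ε

end RenyiTaylor

end

/-!
Diagonalize `G` and put `tᵢ = λᵢ / λ_max ∈ [0, 1]`. The estimator is `λ_max ^ α` times the average
of `s` independent copies of the Gaussian quadratic form `∑ᵢ p(tᵢ) zᵢ²`, where `p` is the Taylor
polynomial of `t ↦ t ^ α` at `1`, so two errors have to be controlled relative to `∑ᵢ tᵢ ^ α`.

*Truncation.* By the reflection formula the Taylor coefficients decay like
`Γ(α + 1) Γ(k - α) / (π k!)`, and log-convexity of `Γ` turns this into a power of `k - α`; the two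
degrees are exactly what makes the resulting remainder at most `ε ∑ᵢ tᵢ ^ α`. In the rank-deficient
case with `α < 1` only twice this bound is available, but then all terms of the series beyond the
constant one are nonpositive, so that `p(t) ≥ t ^ α` and the error is one-sided.

*Fluctuation.* A Chernoff bound for weighted sums of `zᵢ² - 1` makes the average deviate from
`∑ᵢ p(tᵢ)` by at most `ε ∑ᵢ |p(tᵢ)|` with probability at least `1 - δ`.

Together they place the argument of the logarithm between `1 - 3ε` and `1 / (1 - 3ε)` times its
target.
-/

noncomputable section

namespace RenyiTaylor

open Real

/-! ### Generalized binomial coefficients -/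

section BinomialRing

variable {R : Type*} [CommRing R] [BinomialRing R]

theorem choose_succ_mul (a : R) (k : ℕ) :
    Ring.choose a (k + 1) * (k + 1) = Ring.choose a k * (a - k) := by
  simpa [nsmul_eq_mul, mul_comm] using Ring.choose_smul_choose a (Nat.le_succ k)

theorem choose_succ_mul_eq_mul_choose_sub_one (a : R) (k : ℕ) :
    Ring.choose a (k + 1) * (k + 1) = a * Ring.choose (a - 1) k := by
  simpa [nsmul_eq_mul, mul_comm] using Ring.choose_smul_choose a (Nat.succ_pos k)

theorem choose_succ_eq_add (a : R) (k : ℕ) :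
    Ring.choose a (k + 1) = Ring.choose (a - 1) k + Ring.choose (a - 1) (k + 1) := by
  simpa using Ring.choose_succ_succ (a - 1) k

theorem sum_range_choose_mul_neg_one_pow (a : R) (m : ℕ) :
    ∑ k ∈ Finset.range (m + 1), Ring.choose a k * (-1) ^ k =
      (-1) ^ m * Ring.choose (a - 1) m := by
  induction m with
  | zero => simp
  | succ m ih =>
    rw [Finset.sum_range_succ, ih, choose_succ_eq_add]
    ring

end BinomialRing

theorem neg_one_pow_mul_choose_nonneg {a : ℝ} (ha : a ≤ 0) (k : ℕ) :
    0 ≤ (-1) ^ k * Ring.choose a k := by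
  induction k with
  | zero => simp
  | succ k ih =>
    have hstep : (-1) ^ (k + 1) * Ring.choose a (k + 1) * (k + 1 : ℝ) =
        ((-1) ^ k * Ring.choose a k) * (k - a) := by
      rw [mul_assoc, choose_succ_mul]
      ring
    refine nonneg_of_mul_nonneg_left (hstep ▸ mul_nonneg ih ?_) (by positivity)
    linarith [k.cast_nonneg (α := ℝ)]

theorem neg_one_pow_mul_choose_succ_nonpos {a : ℝ} (ha : 0 ≤ a) (ha1 : a ≤ 1) (k : ℕ) :
    (-1) ^ (k + 1) * Ring.choose a (k + 1) ≤ 0 := by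
  have hstep : (-1) ^ (k + 1) * Ring.choose a (k + 1) * (k + 1 : ℝ) =
      -(a * ((-1) ^ k * Ring.choose (a - 1) k)) := by
    rw [mul_assoc, choose_succ_mul_eq_mul_choose_sub_one]
    ring
  refine nonpos_of_mul_nonpos_left (hstep ▸ neg_nonpos.2 (mul_nonneg ha ?_)) (by positivity)
  exact neg_one_pow_mul_choose_nonneg (by linarith) k

theorem abs_choose_succ_eq_sub {a : ℝ} (ha : 0 ≤ a) {k : ℕ} (hk : a ≤ k + 1) :
    |Ring.choose a (k + 1)| = |Ring.choose (a - 1) k| - |Ring.choose (a - 1) (k + 1)| := by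
  have hk0 : (0 : ℝ) < k + 1 := by positivity
  have h₁ : |Ring.choose a (k + 1)| * (k + 1) = a * |Ring.choose (a - 1) k| := by
    rw [← abs_of_pos hk0, ← abs_mul, choose_succ_mul_eq_mul_choose_sub_one, abs_mul,
      abs_of_nonneg ha]
  have h₂ : |Ring.choose (a - 1) (k + 1)| * (k + 1) = |Ring.choose (a - 1) k| * (k + 1 - a) := by
    rw [← abs_of_pos hk0, ← abs_mul, choose_succ_mul, abs_mul, abs_of_pos hk0,
      abs_of_nonpos (show a - 1 - k ≤ 0 by linarith)]
    ring
  refine mul_right_cancel₀ hk0.ne' ?_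
  linear_combination h₁ + h₂

theorem sum_range_abs_choose_add {a : ℝ} (ha : 0 ≤ a) {m : ℕ} (hm : a ≤ m + 1) (N : ℕ) :
    ∑ j ∈ Finset.range N, |Ring.choose a (j + (m + 1))| =
      |Ring.choose (a - 1) m| - |Ring.choose (a - 1) (N + m)| := by
  induction N with
  | zero => simp
  | succ N ih =>
    have hN : a ≤ (N + m : ℕ) + 1 := by
      push_cast
      linarith [N.cast_nonneg (α := ℝ)]
    rw [Finset.sum_range_succ, ih, ← add_assoc, abs_choose_succ_eq_sub ha hN,
      Nat.add_right_comm]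
    ring

theorem Gamma_add_one_mul_rpow_le {y b : ℝ} (hy : 0 < y) (hb : 0 ≤ b) :
    Gamma (y + 1) * y ^ b ≤ Gamma (y + 1 + b) := by
  rcases hb.eq_or_lt with rfl | hb
  · simp
  have hΓ := Gamma_pos_of_pos hy
  have hΓ₁ := Gamma_pos_of_pos (show 0 < y + 1 by linarith)
  have hΓb := Gamma_pos_of_pos (show 0 < y + 1 + b by linarith)
  have hslope := convexOn_log_Gamma.slope_mono_adjacent (x := y) (y := y + 1) (z := y + 1 + b)
    hy (show 0 < y + 1 + b by linarith) (by linarith) (by linarith)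
  have hlog : log (Gamma (y + 1)) - log (Gamma y) = log y := by
    rw [Gamma_add_one hy.ne', log_mul hy.ne' hΓ.ne', add_sub_cancel_right]
  simp only [Function.comp_apply, add_sub_cancel_left, div_one] at hslope
  rw [hlog, le_div_iff₀ hb] at hslope
  rw [← log_le_log_iff (by positivity) hΓb, log_mul hΓ₁.ne' (by positivity), log_rpow hy]
  linarith

theorem choose_mul_factorial_mul_pi {a : ℝ} (ha : sin (π * a) ≠ 0) (k : ℕ) :
    Ring.choose a k * k.factorial * π =
      (-1) ^ (k + 1) * sin (π * a) * Gamma (a + 1) * Gamma (k - a) := by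
  induction k with
  | zero =>
    have hrefl := Gamma_mul_Gamma_one_sub (-a)
    rw [mul_neg, sin_neg, sub_neg_eq_add, eq_div_iff (neg_ne_zero.2 ha), add_comm 1 a] at hrefl
    simp only [Ring.choose_zero_right, Nat.factorial_zero, Nat.cast_zero, Nat.cast_one, zero_sub]
    linear_combination -hrefl
  | succ k ih =>
    have hka : (k : ℝ) - a ≠ 0 := by
      intro h
      rw [← sub_eq_zero.1 h, mul_comm, sin_nat_mul_pi] at ha
      exact ha rfl
    have hΓ : Gamma ((k + 1 : ℕ) - a) = (k - a) * Gamma (k - a) := by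
      rw [← Gamma_add_one hka]
      push_cast
      ring_nf
    rw [hΓ, Nat.factorial_succ]
    push_cast
    linear_combination k.factorial * π * choose_succ_mul a k + (a - k) * ih

theorem abs_choose_mul_factorial_mul_pi_le {a : ℝ} (ha : -1 < a) {k : ℕ} (hk : a < k) :
    |Ring.choose a k| * k.factorial * π ≤ Gamma (a + 1) * Gamma (k - a) := by
  have hΓ₁ := Gamma_pos_of_pos (show 0 < a + 1 by linarith)
  have hΓ₂ := Gamma_pos_of_pos (show 0 < k - a by linarith)
  by_cases hsin : sin (π * a) = 0
  · obtain ⟨j, rfl⟩ : ∃ j : ℕ, a = j := by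
      obtain ⟨z, hz⟩ := sin_eq_zero_iff.1 hsin
      obtain rfl : (z : ℝ) = a := mul_right_cancel₀ pi_ne_zero (by rw [hz, mul_comm])
      have hz0 : -1 < z := by exact_mod_cast ha
      lift z to ℕ using by lia
      exact ⟨z, rfl⟩
    rw [Ring.choose_natCast, Nat.choose_eq_zero_of_lt (by exact_mod_cast hk)]
    simp only [Nat.cast_zero, abs_zero, zero_mul]
    positivity
  · calc |Ring.choose a k| * k.factorial * π
        = |Ring.choose a k * k.factorial * π| := by
          rw [abs_mul, abs_mul, Nat.abs_cast, abs_of_pos pi_pos]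
      _ = |sin (π * a)| * (Gamma (a + 1) * Gamma (k - a)) := by
          rw [choose_mul_factorial_mul_pi hsin, mul_assoc, abs_mul, abs_mul, abs_neg_one_pow,
            one_mul, abs_of_pos (mul_pos hΓ₁ hΓ₂)]
      _ ≤ _ := mul_le_of_le_one_left (by positivity) (abs_sin_le_one _)

theorem abs_choose_le {a y : ℝ} (ha : -1 < a) (hy : 0 < y) {k : ℕ} (hk : a + y + 1 ≤ k) :
    |Ring.choose a k| ≤ Gamma (a + 1) / (π * y ^ (a + 1)) := by
  have hΓ := Gamma_pos_of_pos (show 0 < k - a by linarith)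
  have hWendel : Gamma (k - a) * y ^ (a + 1) ≤ k.factorial := by
    calc Gamma (k - a) * y ^ (a + 1) ≤ Gamma (k - a) * (k - a - 1) ^ (a + 1) := by
          gcongr <;> linarith
      _ ≤ Gamma (k - a + (a + 1)) := by
          simpa using Gamma_add_one_mul_rpow_le (y := k - a - 1) (b := a + 1)
            (by linarith) (by linarith)
      _ = k.factorial := by
          rw [← Gamma_nat_eq_factorial]
          ring_nf
  rw [le_div_iff₀ (by positivity)]
  refine le_of_mul_le_mul_right ?_ hΓ
  calc |Ring.choose a k| * (π * y ^ (a + 1)) * Gamma (k - a)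
      = |Ring.choose a k| * π * (Gamma (k - a) * y ^ (a + 1)) := by ring
    _ ≤ |Ring.choose a k| * π * k.factorial := by gcongr
    _ = |Ring.choose a k| * k.factorial * π := by ring
    _ ≤ Gamma (a + 1) * Gamma (k - a) := abs_choose_mul_factorial_mul_pi_le ha (by linarith)

/-! ### Taylor polynomials of `t ↦ t ^ α` -/

/-- The Taylor polynomial of degree `m` of `t ↦ t ^ α` at `t = 1`; applied to the spectrum of
`λ_max⁻¹ • G` it describes the matrix polynomial of the estimator. -/
def taylorPoly (α : ℝ) (m : ℕ) (t : ℝ) : ℝ :=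
  ∑ k ∈ Finset.range (m + 1), Ring.choose α k * (t - 1) ^ k

theorem taylorPoly_one (α : ℝ) (m : ℕ) : taylorPoly α m 1 = 1 := by
  simp [taylorPoly, Finset.sum_range_succ']

theorem taylorPoly_zero (α : ℝ) (m : ℕ) :
    taylorPoly α m 0 = (-1) ^ m * Ring.choose (α - 1) m := by
  simpa [taylorPoly] using sum_range_choose_mul_neg_one_pow α m

theorem hasSum_choose_mul_pow (α : ℝ) {t : ℝ} (ht0 : 0 < t) (ht2 : t < 2) :
    HasSum (fun k : ℕ => Ring.choose α k * (t - 1) ^ k) (t ^ α) := by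
  have hmem : t - 1 ∈ Metric.eball (0 : ℝ) 1 := by
    rw [← ENNReal.ofReal_one, Metric.eball_ofReal, mem_ball_zero_iff, norm_eq_abs, abs_lt]
    constructor <;> linarith
  simpa [binomialSeries, FormalMultilinearSeries.ofScalars_apply_eq, mul_comm] using
    (one_add_rpow_hasFPowerSeriesOnBall_zero (a := α)).hasSum hmem

theorem hasSum_rpow_sub_taylorPoly (α : ℝ) (m : ℕ) {t : ℝ} (ht0 : 0 < t) (ht2 : t < 2) :
    HasSum (fun j : ℕ => Ring.choose α (j + (m + 1)) * (t - 1) ^ (j + (m + 1)))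
      (t ^ α - taylorPoly α m t) :=
  (hasSum_nat_add_iff' (m + 1)).2 (hasSum_choose_mul_pow α ht0 ht2)

theorem abs_rpow_sub_taylorPoly_le_abs_choose {α : ℝ} (hα : 0 < α) {m : ℕ} (hm : α ≤ m + 1)
    {t : ℝ} (ht0 : 0 ≤ t) (ht1 : t ≤ 1) :
    |t ^ α - taylorPoly α m t| ≤ |Ring.choose (α - 1) m| := by
  rcases ht0.eq_or_lt with rfl | ht0
  · rw [zero_rpow hα.ne', taylorPoly_zero, zero_sub, abs_neg, abs_mul, abs_neg_one_pow, one_mul]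
  have hpartial (N : ℕ) :
      |∑ j ∈ Finset.range N, Ring.choose α (j + (m + 1)) * (t - 1) ^ (j + (m + 1))| ≤
        |Ring.choose (α - 1) m| := by
    have ht : |t - 1| ≤ 1 := abs_le.2 ⟨by linarith, by linarith⟩
    calc |∑ j ∈ Finset.range N, Ring.choose α (j + (m + 1)) * (t - 1) ^ (j + (m + 1))|
        ≤ ∑ j ∈ Finset.range N, |Ring.choose α (j + (m + 1)) * (t - 1) ^ (j + (m + 1))| :=
          Finset.abs_sum_le_sum_abs _ _
      _ ≤ ∑ j ∈ Finset.range N, |Ring.choose α (j + (m + 1))| := by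
          refine Finset.sum_le_sum fun j _ => ?_
          rw [abs_mul, abs_pow]
          exact mul_le_of_le_one_right (abs_nonneg _) (pow_le_one₀ (abs_nonneg _) ht)
      _ = |Ring.choose (α - 1) m| - |Ring.choose (α - 1) (N + m)| :=
          sum_range_abs_choose_add hα.le hm N
      _ ≤ |Ring.choose (α - 1) m| := sub_le_self _ (abs_nonneg _)
  exact le_of_tendsto' (hasSum_rpow_sub_taylorPoly α m ht0 (by linarith)).tendsto_sum_nat.abs
    hpartial

theorem abs_rpow_sub_taylorPoly_le_geometric {α K : ℝ} {m : ℕ} {t : ℝ} (ht0 : 0 < t)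
    (ht1 : t ≤ 1) (hK : ∀ k, m + 1 ≤ k → |Ring.choose α k| ≤ K) :
    |t ^ α - taylorPoly α m t| ≤ K * (1 - t) ^ (m + 1) / t := by
  have hgeom := (hasSum_geometric_of_lt_one (r := 1 - t) (by linarith) (by linarith)).mul_left
    (K * (1 - t) ^ (m + 1))
  rw [sub_sub_cancel, ← div_eq_mul_inv] at hgeom
  rw [← (hasSum_rpow_sub_taylorPoly α m ht0 (by linarith)).tsum_eq, ← norm_eq_abs]
  refine tsum_of_norm_bounded hgeom fun j => ?_
  rw [norm_eq_abs, abs_mul, abs_pow, abs_sub_comm, abs_of_nonneg (sub_nonneg.2 ht1), mul_assoc,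
    ← pow_add, Nat.add_comm (m + 1) j]
  exact mul_le_mul_of_nonneg_right (hK _ (by lia)) (pow_nonneg (by linarith) _)

theorem rpow_le_taylorPoly {α : ℝ} (hα : 0 < α) (hα1 : α ≤ 1) (m : ℕ) {t : ℝ}
    (ht0 : 0 ≤ t) (ht1 : t ≤ 1) : t ^ α ≤ taylorPoly α m t := by
  rcases ht0.eq_or_lt with rfl | ht0
  · rw [zero_rpow hα.ne', taylorPoly_zero]
    exact neg_one_pow_mul_choose_nonneg (by linarith) m
  · rw [← sub_nonpos]
    refine hasSum_le (fun j => ?_) (hasSum_rpow_sub_taylorPoly α m ht0 (by linarith)) hasSum_zero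
    rw [show t - 1 = -1 * (1 - t) by ring, mul_pow, ← mul_assoc, mul_comm (Ring.choose α _)]
    exact mul_nonpos_of_nonpos_of_nonneg (neg_one_pow_mul_choose_succ_nonpos hα.le hα1 (j + m))
      (pow_nonneg (by linarith) _)

/-! ### The two choices of the degree -/

theorem lambertW0_mul_exp {z : ℝ} (hz : 0 ≤ z) : lambertW0 z * exp (lambertW0 z) = z := by
  refine Function.invFunOn_eq (f := fun w : ℝ => w * exp w) (s := Set.Ici (-1)) ?_
  have hcont : ContinuousOn (fun w : ℝ => w * exp w) (Set.Icc 0 z) := by fun_prop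
  obtain ⟨w, hw, hwz⟩ := intermediate_value_Icc hz hcont
    (show z ∈ Set.Icc _ _ from ⟨by simpa using hz, le_mul_of_one_le_right hz (one_le_exp hz)⟩)
  exact ⟨w, neg_one_lt_zero.le.trans hw.1, hwz⟩

theorem lambertW0_pos {z : ℝ} (hz : 0 < z) : 0 < lambertW0 z :=
  pos_of_mul_pos_left (hz.trans_eq (lambertW0_mul_exp hz.le).symm) (exp_pos _).le

theorem abs_rpow_sub_taylorPoly_le_one_sub_rpow {α y : ℝ} (hα : -1 < α) (hy : 0 < y) {m : ℕ}
    (hm : α + y ≤ m) {t : ℝ} (ht0 : 0 < t) (ht1 : t ≤ 1) :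
    |t ^ α - taylorPoly α m t| ≤ Gamma (α + 1) / (π * y ^ (α + 1)) * (1 - t) ^ y / t := by
  have hΓ := Gamma_pos_of_pos (show 0 < α + 1 by linarith)
  have hchoose (k : ℕ) (hk : m + 1 ≤ k) :
      |Ring.choose α k| ≤ Gamma (α + 1) / (π * y ^ (α + 1)) := by
    have hk' : (m : ℝ) + 1 ≤ k := by exact_mod_cast hk
    exact abs_choose_le hα hy (by linarith)
  refine (abs_rpow_sub_taylorPoly_le_geometric ht0 ht1 hchoose).trans ?_
  gcongr
  rw [← rpow_natCast]
  refine rpow_le_rpow_of_exponent_ge' (by linarith) (by linarith) hy.le ?_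
  push_cast
  linarith

theorem abs_rpow_sub_taylorPoly_le_mul_rpow {α κ y : ℝ} (hα : -1 < α) (hκ : 0 < κ) (hy : 0 < y)
    {m : ℕ} (hm : α + y ≤ m) {t : ℝ} (ht : 1 / κ ≤ t) (ht1 : t ≤ 1) :
    |t ^ α - taylorPoly α m t| ≤
      Gamma (α + 1) / π * ((1 - 1 / κ) ^ y * (κ / y) ^ (α + 1)) * t ^ α := by
  have ht0 : 0 < t := (one_div_pos.2 hκ).trans_le ht
  have hκ1 : 0 ≤ 1 - 1 / κ := sub_nonneg.2 (ht.trans ht1)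
  have hΓ := Gamma_pos_of_pos (show 0 < α + 1 by linarith)
  have hinv : t⁻¹ ≤ κ ^ (α + 1) * t ^ α := by
    calc t⁻¹ = t⁻¹ ^ (α + 1) * t ^ α := by
          rw [rpow_add_one (by positivity), inv_rpow ht0.le, mul_right_comm,
            inv_mul_cancel₀ (by positivity), one_mul]
      _ ≤ κ ^ (α + 1) * t ^ α := by
          gcongr
          · linarith
          · exact inv_le_of_inv_le₀ hκ (one_div κ ▸ ht)
  calc |t ^ α - taylorPoly α m t|
      ≤ Gamma (α + 1) / (π * y ^ (α + 1)) * (1 - t) ^ y * t⁻¹ :=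
        abs_rpow_sub_taylorPoly_le_one_sub_rpow hα hy hm ht0 ht1
    _ ≤ Gamma (α + 1) / (π * y ^ (α + 1)) * (1 - 1 / κ) ^ y * (κ ^ (α + 1) * t ^ α) := by
        gcongr
    _ = Gamma (α + 1) / π * ((1 - 1 / κ) ^ y * (κ / y) ^ (α + 1)) * t ^ α := by
        rw [div_rpow hκ.le hy.le]
        field_simp

theorem betaParam_pos {κ α : ℝ} (hα : 0 < α + 1) (hκ : 1 < κ) : 0 < betaParam κ α := by
  have hκ0 : 0 < 1 / κ := by positivity
  have hκ1 : 1 / κ < 1 := (div_lt_one (by linarith)).2 hκ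
  exact div_pos (neg_pos.2 (log_neg (by linarith) (by linarith))) hα

theorem one_sub_one_div_rpow_eq_exp {κ α : ℝ} (hα : α + 1 ≠ 0) (hκ : 1 < κ) (y : ℝ) :
    (1 - 1 / κ) ^ y = (exp (betaParam κ α * y) ^ (α + 1))⁻¹ := by
  have hκ1 : 1 / κ < 1 := (div_lt_one (by linarith)).2 hκ
  rw [rpow_def_of_pos (by linarith), ← exp_mul, ← exp_neg, betaParam]
  congr 1
  field_simp

theorem abs_rpow_sub_taylorPoly_le_of_fullRankDegree_le {α ε κ : ℝ} (hα : -1 < α) (hε : 0 < ε)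
    (hκ : 1 ≤ κ) {m : ℕ} (hm : fullRankDegree κ α ε ≤ m) {t : ℝ} (ht : 1 / κ ≤ t)
    (ht1 : t ≤ 1) : |t ^ α - taylorPoly α m t| ≤ ε * t ^ α := by
  rcases hκ.eq_or_lt with rfl | hκ
  · obtain rfl : t = 1 := le_antisymm ht1 (by simpa using ht)
    simp [taylorPoly_one, hε.le]
  have hα1 : 0 < α + 1 := by linarith
  have hβ := betaParam_pos hα1 hκ
  set β := betaParam κ α
  set c := Gamma (α + 1) / (ε * π) with hc_def
  have hc : 0 < c := div_pos (Gamma_pos_of_pos hα1) (by positivity)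
  have hz : 0 < κ * β * c ^ (1 / (α + 1)) := by positivity
  set y := lambertW0 (κ * β * c ^ (1 / (α + 1))) / β with hy_def
  have hy : 0 < y := div_pos (lambertW0_pos hz) hβ
  have hy_exp : κ / y = exp (β * y) / c ^ (1 / (α + 1)) := by
    have hW := lambertW0_mul_exp hz.le
    rw [← mul_div_cancel₀ (lambertW0 _) hβ.ne', ← hy_def] at hW
    rw [div_eq_div_iff (by positivity) (by positivity)]
    refine mul_left_cancel₀ hβ.ne' ?_
    linear_combination -hW
  have hfactor : (1 - 1 / κ) ^ y * (κ / y) ^ (α + 1) = c⁻¹ := by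
    rw [one_sub_one_div_rpow_eq_exp hα1.ne' hκ, hy_exp, div_rpow (by positivity) (by positivity),
      ← rpow_mul hc.le, one_div_mul_cancel hα1.ne', rpow_one]
    field_simp
    rw [mul_comm y β]
  refine (abs_rpow_sub_taylorPoly_le_mul_rpow hα (by linarith) hy (Nat.ceil_le.1 hm) ht
    ht1).trans_eq ?_
  have := (Gamma_pos_of_pos hα1).ne'
  rw [hfactor, hc_def]
  field_simp

theorem gammaFactor_pos {α : ℝ} (hα : 0 < α) : 0 < gammaFactor α := by
  unfold gammaFactor
  split_ifs <;> exact Gamma_pos_of_pos (by linarith)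

theorem Gamma_le_two_mul_gammaFactor {α : ℝ} (hα : 0 < α) : Gamma α ≤ 2 * gammaFactor α := by
  have hΓ := Gamma_pos_of_pos hα
  unfold gammaFactor
  split_ifs with h
  · linarith
  · rw [Gamma_add_one hα.ne']
    nlinarith

theorem Gamma_le_gammaFactor {α : ℝ} (hα : 1 ≤ α) : Gamma α ≤ gammaFactor α := by
  have hα0 : 0 < α := by linarith
  rw [gammaFactor, if_neg (by linarith), Gamma_add_one hα0.ne']
  exact le_mul_of_one_le_left (Gamma_pos_of_pos hα0).le hα

theorem mul_abs_rpow_sub_taylorPoly_le_of_rankDeficientDegree_le {α ε : ℝ} (hα : 0 < α)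
    (hε : 0 < ε) {n : ℕ} (hn : n ≠ 0) {m : ℕ} (hm : rankDeficientDegree n α ε ≤ m) {t : ℝ}
    (ht0 : 0 ≤ t) (ht1 : t ≤ 1) :
    n * |t ^ α - taylorPoly α m t| ≤ ε * (Gamma α / gammaFactor α) := by
  have hc := gammaFactor_pos hα
  set y := (n * gammaFactor α / (ε * π)) ^ (1 / α) with hy_def
  have hy : 0 < y := by positivity
  have hym : α + y ≤ m := Nat.ceil_le.1 hm
  have hyα : y ^ α = n * gammaFactor α / (ε * π) := by
    rw [hy_def, ← rpow_mul (by positivity), one_div_mul_cancel hα.ne', rpow_one]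
  calc n * |t ^ α - taylorPoly α m t| ≤ n * |Ring.choose (α - 1) m| := by
        refine mul_le_mul_of_nonneg_left ?_ n.cast_nonneg
        exact abs_rpow_sub_taylorPoly_le_abs_choose hα (by linarith) ht0 ht1
    _ ≤ n * (Gamma α / (π * y ^ α)) := by
        gcongr
        simpa using abs_choose_le (a := α - 1) (by linarith) hy (by linarith)
    _ = ε * (Gamma α / gammaFactor α) := by
        rw [hyα]
        field_simp

/-! ### Concentration of Gaussian quadratic forms -/

theorem inv_sqrt_one_sub_le_exp {y : ℝ} (hy : |y| ≤ 1 / 2) :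
    (√(1 - y))⁻¹ ≤ exp ((y + y ^ 2) / 2) := by
  have hy₂ := (abs_le.1 hy).2
  have hexp : 1 ≤ (1 - y) * exp (y + y ^ 2) := by
    rcases le_total 0 y with h0 | h0
    · have hquad := quadratic_le_exp_of_nonneg (x := y + y ^ 2) (by positivity)
      refine le_trans ?_ (mul_le_mul_of_nonneg_left hquad (by linarith))
      nlinarith [mul_nonneg (sq_nonneg y) (show 0 ≤ (1 - y) * (1 + y) ^ 2 - 2 * y by nlinarith)]
    · refine le_trans ?_ (mul_le_mul_of_nonneg_left (add_one_le_exp _) (by linarith))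
      nlinarith [mul_nonneg (neg_nonneg.2 h0) (sq_nonneg y)]
  rwa [inv_le_iff_one_le_mul₀ (sqrt_pos.2 (by linarith)), exp_half, ← sqrt_mul (exp_pos _).le,
    one_le_sqrt, mul_comm]

theorem mgf_sq_gaussianReal {c : ℝ} (hc : c < 1 / 2) :
    mgf (fun x => x ^ 2) (gaussianReal 0 1) c = (√(1 - 2 * c))⁻¹ := by
  have hpdf (x : ℝ) : gaussianPDFReal 0 1 x * exp (c * x ^ 2) =
      (√(2 * π))⁻¹ * exp (-(1 / 2 - c) * x ^ 2) := by
    simp only [gaussianPDFReal, NNReal.coe_one, mul_one, sub_zero]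
    rw [mul_assoc, ← exp_add]
    ring_nf
  rw [mgf, integral_gaussianReal_eq_integral_smul one_ne_zero]
  simp_rw [smul_eq_mul, hpdf]
  rw [integral_const_mul, integral_gaussian, ← sqrt_inv, ← sqrt_inv, ← sqrt_mul (by positivity)]
  have : 1 - 2 * c ≠ 0 := by linarith
  rw [show 1 / 2 - c = (1 - 2 * c) / 2 by ring]
  congr 1
  field_simp

theorem mgf_sq_gaussianReal_pos {c : ℝ} (hc : c < 1 / 2) :
    0 < mgf (fun x => x ^ 2) (gaussianReal 0 1) c := by
  rw [mgf_sq_gaussianReal hc]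
  exact inv_pos.2 (sqrt_pos.2 (by linarith))

theorem mgf_sq_gaussianReal_le {c : ℝ} (hc : |c| ≤ 1 / 4) :
    mgf (fun x => x ^ 2) (gaussianReal 0 1) c ≤ exp (c + 2 * c ^ 2) := by
  rw [mgf_sq_gaussianReal (by linarith [le_abs_self c])]
  have h2c : |2 * c| ≤ 1 / 2 := by
    rw [abs_mul, abs_two]
    linarith
  refine (inv_sqrt_one_sub_le_exp h2c).trans_eq ?_
  ring_nf

theorem measureReal_card_mul_le_sum_le {J Ω : Type*} [Fintype J] [MeasurableSpace Ω]
    {μ : Measure Ω} {X : J → Ω → ℝ} (hind : iIndepFun X μ) (hX : ∀ j, AEMeasurable (X j) μ)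
    {θ c : ℝ} (hθ : 0 ≤ θ) (hpos : ∀ j, 0 < mgf (X j) μ θ) (hmgf : ∀ j, mgf (X j) μ θ ≤ exp c)
    (a : ℝ) :
    μ.real {ω | Fintype.card J * a ≤ ∑ j, X j ω} ≤ exp (Fintype.card J * (c - θ * a)) := by
  have : IsProbabilityMeasure μ := hind.isProbabilityMeasure
  have hsum := hind.mgf_sum₀ hX Finset.univ (t := θ)
  have hint : Integrable (fun ω => exp (θ * (∑ j, X j) ω)) μ := by
    rw [← mgf_pos_iff, hsum]
    exact Finset.prod_pos fun j _ => hpos j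
  have hChernoff := measure_ge_le_exp_mul_mgf (Fintype.card J * a) hθ hint
  simp only [Finset.sum_apply] at hChernoff
  refine hChernoff.trans ?_
  rw [hsum]
  calc exp (-θ * (Fintype.card J * a)) * ∏ j, mgf (X j) μ θ
      ≤ exp (-θ * (Fintype.card J * a)) * ∏ _j : J, exp c := by
        gcongr with j
        · exact fun j _ => mgf_nonneg
        · exact hmgf j
    _ = exp (Fintype.card J * (c - θ * a)) := by
        rw [Finset.prod_const, Finset.card_univ, ← exp_nat_mul, ← exp_add]
        ring_nf

section DiagonalForm

variable {ι E : Type*} [Fintype ι] [NormedAddCommGroup E] [InnerProductSpace ℝ E]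

/-- The quadratic form on `E` whose matrix in the orthonormal basis `b` is diagonal with entries
`p i`. -/
def diagonalForm (b : OrthonormalBasis ι ℝ E) (p : ι → ℝ) (v : E) : ℝ :=
  ∑ i, p i * inner ℝ (b i) v ^ 2

theorem diagonalForm_neg (b : OrthonormalBasis ι ℝ E) (p : ι → ℝ) (v : E) :
    diagonalForm b (-p) v = -diagonalForm b p v := by
  simp [diagonalForm]

theorem measurable_diagonalForm [MeasurableSpace E] [BorelSpace E] [SecondCountableTopology E]
    (b : OrthonormalBasis ι ℝ E) (p : ι → ℝ) : Measurable (diagonalForm b p) := by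
  unfold diagonalForm
  fun_prop

variable [FiniteDimensional ℝ E] [MeasurableSpace E] [BorelSpace E]

theorem mgf_diagonalForm_stdGaussian (b : OrthonormalBasis ι ℝ E) (p : ι → ℝ) (θ : ℝ) :
    mgf (diagonalForm b p) (stdGaussian E) θ =
      ∏ i, mgf (fun x => x ^ 2) (gaussianReal 0 1) (θ * p i) := by
  have hmap : Measurable fun x : ι → ℝ => ∑ i, x i • b i := by fun_prop
  have hexp : AEStronglyMeasurable (fun v => exp (θ * diagonalForm b p v))
      (Measure.map (fun x : ι → ℝ => ∑ i, x i • b i) (Measure.pi fun _ => gaussianReal 0 1)) :=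
    (measurable_exp.comp ((measurable_diagonalForm b p).const_mul θ)).aestronglyMeasurable
  have hfactor (x : ι → ℝ) : exp (θ * diagonalForm b p (∑ j, x j • b j)) =
      ∏ i, exp (θ * p i * x i ^ 2) := by
    simp only [diagonalForm, b.orthonormal.inner_right_fintype, Finset.mul_sum, exp_sum, mul_assoc]
  rw [stdGaussian_eq_map_pi_orthonormalBasis b, mgf_map hmap.aemeasurable hexp]
  simp only [mgf, Function.comp_apply, hfactor]
  exact integral_fintype_prod_eq_prod (fun i (x : ℝ) => exp (θ * p i * x ^ 2))

theorem mgf_diagonalForm_stdGaussian_pos (b : OrthonormalBasis ι ℝ E) {p : ι → ℝ} {θ : ℝ}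
    (hθ : ∀ i, θ * p i < 1 / 2) : 0 < mgf (diagonalForm b p) (stdGaussian E) θ := by
  rw [mgf_diagonalForm_stdGaussian]
  exact Finset.prod_pos fun i _ => mgf_sq_gaussianReal_pos (hθ i)

theorem mgf_diagonalForm_stdGaussian_le (b : OrthonormalBasis ι ℝ E) {p : ι → ℝ} {θ : ℝ}
    (hθ : ∀ i, |θ * p i| ≤ 1 / 4) :
    mgf (diagonalForm b p) (stdGaussian E) θ ≤
      exp (θ * ∑ i, p i + 2 * θ ^ 2 * ∑ i, p i ^ 2) := by
  have hexp : θ * ∑ i, p i + 2 * θ ^ 2 * ∑ i, p i ^ 2 = ∑ i, (θ * p i + 2 * (θ * p i) ^ 2) := by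
    simp only [Finset.sum_add_distrib, Finset.mul_sum, mul_pow, mul_assoc]
  rw [mgf_diagonalForm_stdGaussian, hexp, exp_sum]
  exact Finset.prod_le_prod (fun _ _ => mgf_nonneg) fun i _ => mgf_sq_gaussianReal_le (hθ i)

section Sample

variable {J Ω : Type*} [Fintype J] [MeasurableSpace Ω] {μ : Measure Ω} {g : J → Ω → E}

theorem measureReal_card_mul_le_sum_diagonalForm_le
    (hg : ∀ j, HasLaw (g j) (stdGaussian E) μ) (hind : iIndepFun g μ)
    (b : OrthonormalBasis ι ℝ E) {p : ι → ℝ} {B ε : ℝ} (hB : 0 < B)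
    (hpB : ∑ i, p i ^ 2 ≤ B ^ 2) (hε : 0 ≤ ε) (hε1 : ε ≤ 1) :
    μ.real {ω | Fintype.card J * (∑ i, p i + ε * B) ≤ ∑ j, diagonalForm b p (g j ω)} ≤
      exp (-(Fintype.card J * ε ^ 2 / 8)) := by
  set θ := ε / (4 * B) with hθ
  have hθ0 : 0 ≤ θ := by positivity
  have hθp (i : ι) : |θ * p i| ≤ 1 / 4 := by
    have hpi : |p i| ≤ B := abs_le_of_sq_le_sq
      ((Finset.single_le_sum (fun j _ => sq_nonneg (p j)) (Finset.mem_univ i)).trans hpB) hB.le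
    calc |θ * p i| = θ * |p i| := by rw [abs_mul, abs_of_nonneg hθ0]
      _ ≤ θ * B := by gcongr
      _ = ε / 4 := by rw [hθ]; field_simp
      _ ≤ 1 / 4 := by linarith
  have hX (j : J) : AEMeasurable (fun ω => diagonalForm b p (g j ω)) μ :=
    (measurable_diagonalForm b p).comp_aemeasurable (hg j).aemeasurable
  have hmgf (j : J) : mgf (fun ω => diagonalForm b p (g j ω)) μ θ =
      mgf (diagonalForm b p) (stdGaussian E) θ := by
    rw [← (hg j).map_eq, mgf_map (hg j).aemeasurable
      (measurable_exp.comp ((measurable_diagonalForm b p).const_mul θ)).aestronglyMeasurable]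
    rfl
  refine (measureReal_card_mul_le_sum_le (hind.comp (fun _ => diagonalForm b p)
    fun _ => measurable_diagonalForm b p) hX hθ0 (fun j => ?_)
    (fun j => (hmgf j).trans_le (mgf_diagonalForm_stdGaussian_le b hθp)) _).trans ?_
  · refine (hmgf j).symm ▸ mgf_diagonalForm_stdGaussian_pos b fun i => ?_
    linarith [le_abs_self (θ * p i), hθp i]
  · refine exp_le_exp.2 ?_
    calc Fintype.card J * (θ * ∑ i, p i + 2 * θ ^ 2 * ∑ i, p i ^ 2 - θ * (∑ i, p i + ε * B))
        ≤ Fintype.card J * (θ * ∑ i, p i + 2 * θ ^ 2 * B ^ 2 - θ * (∑ i, p i + ε * B)) := by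
          gcongr
      _ = -(Fintype.card J * ε ^ 2 / 8) := by
          rw [hθ]
          field_simp
          ring

theorem one_sub_two_mul_exp_le_measureReal_abs_sum_diagonalForm_sub_le
    (hg : ∀ j, HasLaw (g j) (stdGaussian E) μ) (hind : iIndepFun g μ)
    (b : OrthonormalBasis ι ℝ E) {p : ι → ℝ} {B ε : ℝ} (hB : 0 < B)
    (hpB : ∑ i, p i ^ 2 ≤ B ^ 2) (hε : 0 ≤ ε) (hε1 : ε ≤ 1) :
    1 - 2 * exp (-(Fintype.card J * ε ^ 2 / 8)) ≤
      μ.real {ω | |∑ j, diagonalForm b p (g j ω) - Fintype.card J * ∑ i, p i| ≤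
        Fintype.card J * (ε * B)} := by
  have : IsProbabilityMeasure μ := hind.isProbabilityMeasure
  set s := (Fintype.card J : ℝ)
  set S : Ω → ℝ := fun ω => ∑ j, diagonalForm b p (g j ω)
  have hupper := measureReal_card_mul_le_sum_diagonalForm_le hg hind b hB hpB hε hε1
  have hlower := measureReal_card_mul_le_sum_diagonalForm_le (p := -p) hg hind b hB
    (by simpa using hpB) hε hε1
  simp only [diagonalForm_neg, Pi.neg_apply, Finset.sum_neg_distrib] at hlower
  have hcover : Set.univ ⊆ {ω | |S ω - s * ∑ i, p i| ≤ s * (ε * B)} ∪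
      ({ω | s * (∑ i, p i + ε * B) ≤ S ω} ∪ {ω | s * (-∑ i, p i + ε * B) ≤ -S ω}) := by
    intro ω _
    by_contra! hω
    simp only [Set.mem_union, Set.mem_ofPred_eq, not_or, not_le] at hω
    exact hω.1.not_ge (abs_le.2 ⟨by linarith, by linarith⟩)
  have hunion := (measureReal_mono hcover (measure_ne_top μ _)).trans (measureReal_union_le _ _)
  rw [probReal_univ] at hunion
  linarith [measureReal_union_le (μ := μ) {ω | s * (∑ i, p i + ε * B) ≤ S ω}
    {ω | s * (-∑ i, p i + ε * B) ≤ -S ω}]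

end Sample

end DiagonalForm

theorem exp_neg_le_of_sampleSize_le {δ ε : ℝ} (hδ : 0 < δ) (hε : 0 < ε) {s : ℕ}
    (hs : sampleSize δ ε ≤ s) : exp (-(s * ε ^ 2 / 8)) ≤ δ / 2 := by
  have hlog : 8 * log (2 / δ) / ε ^ 2 ≤ s := Nat.ceil_le.1 hs
  rw [div_le_iff₀ (by positivity)] at hlog
  calc exp (-(s * ε ^ 2 / 8)) ≤ exp (-log (2 / δ)) := exp_le_exp.2 (by linarith)
    _ = δ / 2 := by rw [exp_neg, exp_log (by positivity), inv_div]

theorem sampleSize_pos {δ ε : ℝ} (hδ : 0 < δ) (hδ2 : δ < 2) (hε : 0 < ε) :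
    0 < sampleSize δ ε := by
  have hlog : 0 < log (2 / δ) := log_pos ((one_lt_div hδ).2 hδ2)
  exact Nat.ceil_pos.2 (by positivity)

/-! ### Normalized eigenvalues -/

theorem pow_mulVec_of_mulVec_eq_smul {ι R : Type*} [Fintype ι] [DecidableEq ι] [CommSemiring R]
    {A : Matrix ι ι R} {v : ι → R} {c : R} (h : A *ᵥ v = c • v) (k : ℕ) :
    A ^ k *ᵥ v = c ^ k • v := by
  induction k with
  | zero => simp
  | succ k ih => rw [pow_succ, ← mulVec_mulVec, h, mulVec_smul, ih, smul_smul, ← pow_succ']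

theorem dotProduct_mulVec_eq_diagonalForm {ι κ : Type*} [Fintype ι] [Fintype κ]
    {A : Matrix ι ι ℝ} {b : OrthonormalBasis κ ℝ (EuclideanSpace ℝ ι)} {a : κ → ℝ}
    (h : ∀ i, A *ᵥ (b i).ofLp = a i • (b i).ofLp) (v : EuclideanSpace ℝ ι) :
    v.ofLp ⬝ᵥ A *ᵥ v.ofLp = diagonalForm b a v := by
  have hv : v.ofLp = ∑ i, inner ℝ (b i) v • (b i).ofLp := by
    conv_lhs => rw [← b.sum_repr' v]
    simp
  have hAv : A *ᵥ v.ofLp = ∑ i, (inner ℝ (b i) v * a i) • (b i).ofLp := by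
    conv_lhs => rw [hv, mulVec_sum]
    simp only [mulVec_smul, h, smul_smul]
  have hinner (i : κ) : v.ofLp ⬝ᵥ (b i).ofLp = inner ℝ (b i) v := by
    simp [EuclideanSpace.inner_eq_star_dotProduct]
  rw [hAv, dotProduct_sum, diagonalForm]
  refine Finset.sum_congr rfl fun i _ => ?_
  rw [dotProduct_smul, hinner, smul_eq_mul]
  ring

variable {n : ℕ} {G : Matrix (Fin n) (Fin n) ℝ}

/-- The eigenvalues of `λ_max⁻¹ • G`, the matrix whose Taylor expansion around the identity the
estimator truncates. -/
def normalizedEigenvalues (hG : G.IsHermitian) (i : Fin n) : ℝ :=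
  (lambdaMax hG)⁻¹ * hG.eigenvalues i

theorem eigenvalues_le_lambdaMax (hG : G.IsHermitian) (i : Fin n) :
    hG.eigenvalues i ≤ lambdaMax hG :=
  le_ciSup (Set.finite_range _).bddAbove i

theorem lambdaMin_le_eigenvalues (hG : G.IsHermitian) (i : Fin n) :
    lambdaMin hG ≤ hG.eigenvalues i :=
  ciInf_le (Set.finite_range _).bddBelow i

theorem pow_mulVec_eigenvectorBasis (hG : G.IsHermitian) (k : ℕ) (i : Fin n) :
    ((lambdaMax hG)⁻¹ • G - 1) ^ k *ᵥ (hG.eigenvectorBasis i).ofLp =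
      (normalizedEigenvalues hG i - 1) ^ k • (hG.eigenvectorBasis i).ofLp := by
  refine pow_mulVec_of_mulVec_eq_smul ?_ k
  rw [sub_mulVec, smul_mulVec, hG.mulVec_eigenvectorBasis, one_mulVec, smul_smul, sub_smul,
    one_smul, normalizedEigenvalues]

theorem taylorEstimate_eq (hG : G.IsHermitian) (α : ℝ) (m : ℕ) {s : ℕ}
    (g : Fin s → EuclideanSpace ℝ (Fin n)) :
    taylorEstimate hG α m g = 1 / (1 - α) * logb 2 (lambdaMax hG ^ α *
      ((∑ j, diagonalForm hG.eigenvectorBasis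
        (fun i => taylorPoly α m (normalizedEigenvalues hG i)) (g j)) / s)) := by
  have hquad (v : EuclideanSpace ℝ (Fin n)) :
      ∑ k ∈ Finset.range (m + 1), Ring.choose α k *
        (v.ofLp ⬝ᵥ ((lambdaMax hG)⁻¹ • G - 1) ^ k *ᵥ v.ofLp) =
      diagonalForm hG.eigenvectorBasis
        (fun i => taylorPoly α m (normalizedEigenvalues hG i)) v := by
    simp only [dotProduct_mulVec_eq_diagonalForm (pow_mulVec_eigenvectorBasis hG _),
      diagonalForm, taylorPoly, Finset.sum_mul, Finset.mul_sum, mul_assoc]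
    exact Finset.sum_comm
  simp only [taylorEstimate, hquad]
  rw [mul_div_assoc' (lambdaMax hG ^ α), div_mul_eq_mul_div (lambdaMax hG ^ α)]

section PosSemidef

variable (hG : G.PosSemidef) (hG0 : G ≠ 0)
include hG hG0

theorem lambdaMax_pos : 0 < lambdaMax hG.isHermitian := by
  obtain ⟨i, hi⟩ : ∃ i, hG.isHermitian.eigenvalues i ≠ 0 :=
    Function.ne_iff.1 (mt hG.isHermitian.eigenvalues_eq_zero_iff.1 hG0)
  exact ((hG.eigenvalues_nonneg i).lt_of_ne' hi).trans_le (eigenvalues_le_lambdaMax _ i)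

theorem normalizedEigenvalues_nonneg (i : Fin n) : 0 ≤ normalizedEigenvalues hG.isHermitian i :=
  mul_nonneg (inv_nonneg.2 (lambdaMax_pos hG hG0).le) (hG.eigenvalues_nonneg i)

theorem normalizedEigenvalues_le_one (i : Fin n) : normalizedEigenvalues hG.isHermitian i ≤ 1 := by
  rw [normalizedEigenvalues, inv_mul_le_one₀ (lambdaMax_pos hG hG0)]
  exact eigenvalues_le_lambdaMax _ i

theorem one_div_condNumber_le_normalizedEigenvalues (i : Fin n) :
    1 / condNumber hG.isHermitian ≤ normalizedEigenvalues hG.isHermitian i := by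
  rw [condNumber, one_div_div, div_eq_inv_mul]
  exact mul_le_mul_of_nonneg_left (lambdaMin_le_eigenvalues _ i)
    (inv_nonneg.2 (lambdaMax_pos hG hG0).le)

theorem exists_normalizedEigenvalues_eq_one : ∃ i, normalizedEigenvalues hG.isHermitian i = 1 := by
  have : Nonempty (Fin n) := by
    by_contra! hempty
    exact hG0 (Subsingleton.elim _ _)
  obtain ⟨i, hi⟩ := exists_eq_ciSup_of_finite (f := hG.isHermitian.eigenvalues)
  refine ⟨i, ?_⟩
  rw [normalizedEigenvalues, hi]
  exact inv_mul_cancel₀ (lambdaMax_pos hG hG0).ne'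

theorem one_le_sum_normalizedEigenvalues_rpow (α : ℝ) :
    1 ≤ ∑ i, normalizedEigenvalues hG.isHermitian i ^ α := by
  obtain ⟨i, hi⟩ := exists_normalizedEigenvalues_eq_one hG hG0
  rw [← one_rpow α, ← hi]
  exact Finset.single_le_sum (f := fun i => normalizedEigenvalues hG.isHermitian i ^ α)
    (fun i _ => rpow_nonneg (normalizedEigenvalues_nonneg hG hG0 i) α) (Finset.mem_univ i)

theorem one_le_condNumber (hmin : 0 < lambdaMin hG.isHermitian) :
    1 ≤ condNumber hG.isHermitian := by
  obtain ⟨i, hi⟩ := exists_normalizedEigenvalues_eq_one hG hG0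
  have hκ : 0 < condNumber hG.isHermitian := div_pos (lambdaMax_pos hG hG0) hmin
  exact (div_le_one hκ).1 (hi ▸ one_div_condNumber_le_normalizedEigenvalues hG hG0 i)

theorem renyiEntropy_eq (α : ℝ) :
    renyiEntropy hG.isHermitian α = 1 / (1 - α) * logb 2 (lambdaMax hG.isHermitian ^ α *
      ∑ i, normalizedEigenvalues hG.isHermitian i ^ α) := by
  have hL := lambdaMax_pos hG hG0
  rw [renyiEntropy, Finset.mul_sum]
  congr 3 with i
  rw [← mul_rpow hL.le (normalizedEigenvalues_nonneg hG hG0 i), normalizedEigenvalues,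
    mul_inv_cancel_left₀ hL.ne']

theorem sum_abs_rpow_sub_taylorPoly_normalizedEigenvalues_le {α ε C : ℝ} (hα : 0 < α)
    (hε : 0 < ε) (hC1 : 1 ≤ C) (hC : Gamma α ≤ C * gammaFactor α) {m : ℕ}
    (hm : taylorDegree hG.isHermitian α ε ≤ m) :
    ∑ i, |normalizedEigenvalues hG.isHermitian i ^ α -
        taylorPoly α m (normalizedEigenvalues hG.isHermitian i)| ≤
      C * (ε * ∑ i, normalizedEigenvalues hG.isHermitian i ^ α) := by
  set t := normalizedEigenvalues hG.isHermitian
  have ht0 := normalizedEigenvalues_nonneg hG hG0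
  have ht1 := normalizedEigenvalues_le_one hG hG0
  have hT : 1 ≤ ∑ i, t i ^ α := one_le_sum_normalizedEigenvalues_rpow hG hG0 α
  unfold taylorDegree at hm
  split_ifs at hm with hmin
  · calc ∑ i, |t i ^ α - taylorPoly α m (t i)| ≤ ∑ i, ε * t i ^ α :=
          Finset.sum_le_sum fun i _ => abs_rpow_sub_taylorPoly_le_of_fullRankDegree_le
            (by linarith) hε (one_le_condNumber hG hG0 hmin) hm
            (one_div_condNumber_le_normalizedEigenvalues hG hG0 i) (ht1 i)
      _ = 1 * (ε * ∑ i, t i ^ α) := by rw [← Finset.mul_sum, one_mul]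
      _ ≤ C * (ε * ∑ i, t i ^ α) := by gcongr
  · have hn : n ≠ 0 := by
      rintro rfl
      exact hG0 (Subsingleton.elim _ _)
    have hn' : (0 : ℝ) < n := by positivity
    calc ∑ i, |t i ^ α - taylorPoly α m (t i)|
        ≤ ∑ _i : Fin n, ε * (Gamma α / gammaFactor α) / n :=
          Finset.sum_le_sum fun i _ => (le_div_iff₀' hn').2
            (mul_abs_rpow_sub_taylorPoly_le_of_rankDeficientDegree_le hα hε hn hm (ht0 i) (ht1 i))
      _ = Gamma α / gammaFactor α * (ε * 1) := by
          rw [Finset.sum_const, Finset.card_univ, Fintype.card_fin, nsmul_eq_mul]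
          field_simp
      _ ≤ C * (ε * ∑ i, t i ^ α) := by
          gcongr
          exact (div_le_iff₀ (gammaFactor_pos hα)).2 hC

end PosSemidef

/-! ### The estimator -/

section Perturbation

variable {ι : Type*} [Fintype ι] {a p : ι → ℝ} {ε : ℝ}

theorem sum_add_mul_sum_abs_bounds_of_sum_abs_sub_le (ha : ∀ i, 0 ≤ a i) (hε : 0 ≤ ε)
    (hε1 : ε ≤ 1) (h : ∑ i, |a i - p i| ≤ ε * ∑ i, a i) :
    (1 - 3 * ε) * ∑ i, a i ≤ ∑ i, p i - ε * ∑ i, |p i| ∧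
      ∑ i, p i + ε * ∑ i, |p i| ≤ (1 + ε) * (1 + 2 * ε) * ∑ i, a i := by
  have hsum : |∑ i, a i - ∑ i, p i| ≤ ∑ i, |a i - p i| := by
    rw [← Finset.sum_sub_distrib]
    exact Finset.abs_sum_le_sum_abs _ _
  have habs : ∑ i, |p i| ≤ ∑ i, a i + ∑ i, |a i - p i| := by
    rw [← Finset.sum_add_distrib]
    refine Finset.sum_le_sum fun i _ => ?_
    have htri := abs_sub_abs_le_abs_sub (p i) (a i)
    rw [abs_of_nonneg (ha i), abs_sub_comm] at htri
    linarith
  have hεa : 0 ≤ ε * ∑ i, a i := mul_nonneg hε (Finset.sum_nonneg fun i _ => ha i)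
  obtain ⟨hlo, hhi⟩ := abs_le.1 hsum
  constructor <;> nlinarith

theorem sum_add_mul_sum_abs_bounds_of_le (ha : ∀ i, 0 ≤ a i) (hap : ∀ i, a i ≤ p i)
    (hε : 0 ≤ ε) (hε1 : ε ≤ 1) (h : ∑ i, |a i - p i| ≤ 2 * (ε * ∑ i, a i)) :
    (1 - 3 * ε) * ∑ i, a i ≤ ∑ i, p i - ε * ∑ i, |p i| ∧
      ∑ i, p i + ε * ∑ i, |p i| ≤ (1 + ε) * (1 + 2 * ε) * ∑ i, a i := by
  have hle : ∑ i, a i ≤ ∑ i, p i := Finset.sum_le_sum fun i _ => hap i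
  have hsub : ∑ i, |a i - p i| = ∑ i, p i - ∑ i, a i := by
    rw [← Finset.sum_sub_distrib]
    exact Finset.sum_congr rfl fun i _ => by rw [abs_sub_comm, abs_of_nonneg (sub_nonneg.2 (hap i))]
  have habs : ∑ i, |p i| = ∑ i, p i :=
    Finset.sum_congr rfl fun i _ => abs_of_nonneg ((ha i).trans (hap i))
  rw [habs]
  constructor <;> nlinarith

end Perturbation

theorem abs_logb_sub_logb_le {b x y q : ℝ} (hb : 1 < b) (hq : 0 < q) (hx : 0 < x)
    (hxy : q * x ≤ y) (hyx : y ≤ x / q) : |logb b x - logb b y| ≤ |logb b q| := by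
  have hlo := logb_le_logb_of_le hb (mul_pos hq hx) hxy
  have hhi := logb_le_logb_of_le hb ((mul_pos hq hx).trans_le hxy) hyx
  rw [logb_mul hq.ne' hx.ne'] at hlo
  rw [logb_div hx.ne' hq.ne'] at hhi
  rw [abs_le]
  constructor <;> linarith [neg_abs_le (logb b q)]

section PosSemidef

variable (hG : G.PosSemidef) (hG0 : G ≠ 0)
include hG hG0

theorem sum_taylorPoly_normalizedEigenvalues_bounds {α ε : ℝ} (hα : 0 < α) (hε : 0 < ε)
    (hε3 : ε < 1 / 3) {m : ℕ} (hm : taylorDegree hG.isHermitian α ε ≤ m) :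
    (1 - 3 * ε) * ∑ i, normalizedEigenvalues hG.isHermitian i ^ α ≤
        ∑ i, taylorPoly α m (normalizedEigenvalues hG.isHermitian i) -
          ε * ∑ i, |taylorPoly α m (normalizedEigenvalues hG.isHermitian i)| ∧
      ∑ i, taylorPoly α m (normalizedEigenvalues hG.isHermitian i) +
          ε * ∑ i, |taylorPoly α m (normalizedEigenvalues hG.isHermitian i)| ≤
        (∑ i, normalizedEigenvalues hG.isHermitian i ^ α) / (1 - 3 * ε) := by
  set t := normalizedEigenvalues hG.isHermitian
  have ht0 : ∀ i, 0 ≤ t i := normalizedEigenvalues_nonneg hG hG0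
  have ha (i : Fin n) : 0 ≤ t i ^ α := rpow_nonneg (ht0 i) α
  have hε1 : ε ≤ 1 := by linarith
  obtain ⟨hlo, hhi⟩ : (1 - 3 * ε) * ∑ i, t i ^ α ≤
        ∑ i, taylorPoly α m (t i) - ε * ∑ i, |taylorPoly α m (t i)| ∧
      ∑ i, taylorPoly α m (t i) + ε * ∑ i, |taylorPoly α m (t i)| ≤
        (1 + ε) * (1 + 2 * ε) * ∑ i, t i ^ α := by
    rcases le_total α 1 with hα1 | hα1
    · refine sum_add_mul_sum_abs_bounds_of_le ha (fun i => rpow_le_taylorPoly hα hα1 m (ht0 i)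
        (normalizedEigenvalues_le_one hG hG0 i)) hε.le hε1 ?_
      exact sum_abs_rpow_sub_taylorPoly_normalizedEigenvalues_le hG hG0 hα hε one_le_two
        (Gamma_le_two_mul_gammaFactor hα) hm
    · refine sum_add_mul_sum_abs_bounds_of_sum_abs_sub_le ha hε.le hε1 ?_
      simpa only [one_mul] using
        sum_abs_rpow_sub_taylorPoly_normalizedEigenvalues_le hG hG0 hα hε le_rfl
          (by simpa only [one_mul] using Gamma_le_gammaFactor hα1) hm
  have hprod : (1 + ε) * (1 + 2 * ε) * (1 - 3 * ε) ≤ 1 := by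
    linarith only [sq_nonneg ε, pow_pos hε 3]
  have hε3' : 0 < 1 - 3 * ε := by linarith
  refine ⟨hlo, hhi.trans ?_⟩
  rw [← one_div_mul_eq_div]
  exact mul_le_mul_of_nonneg_right ((le_div_iff₀ hε3').2 hprod)
    (Finset.sum_nonneg fun i _ => ha i)

theorem sum_abs_taylorPoly_normalizedEigenvalues_pos {α ε : ℝ} (hα : 0 < α) (hε : 0 < ε)
    (hε3 : ε < 1 / 3) {m : ℕ} (hm : taylorDegree hG.isHermitian α ε ≤ m) :
    0 < ∑ i, |taylorPoly α m (normalizedEigenvalues hG.isHermitian i)| := by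
  obtain ⟨hlo, -⟩ := sum_taylorPoly_normalizedEigenvalues_bounds hG hG0 hα hε hε3 hm
  have hT : 0 < (1 - 3 * ε) * ∑ i, normalizedEigenvalues hG.isHermitian i ^ α :=
    mul_pos (by linarith)
      (zero_lt_one.trans_le (one_le_sum_normalizedEigenvalues_rpow hG hG0 α))
  have habs := Finset.sum_le_sum fun i (_ : i ∈ Finset.univ) =>
    le_abs_self (taylorPoly α m (normalizedEigenvalues hG.isHermitian i))
  have hεabs : 0 ≤ ε * ∑ i, |taylorPoly α m (normalizedEigenvalues hG.isHermitian i)| := by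
    positivity
  linarith

theorem abs_renyiEntropy_sub_taylorEstimate_le {α ε : ℝ} (hα : 0 < α) (hε : 0 < ε)
    (hε3 : ε < 1 / 3) {m : ℕ} (hm : taylorDegree hG.isHermitian α ε ≤ m) {s : ℕ} (hs : 0 < s)
    {g : Fin s → EuclideanSpace ℝ (Fin n)}
    (hg : |∑ j, diagonalForm hG.isHermitian.eigenvectorBasis
          (fun i => taylorPoly α m (normalizedEigenvalues hG.isHermitian i)) (g j) -
        s * ∑ i, taylorPoly α m (normalizedEigenvalues hG.isHermitian i)| ≤
      s * (ε * ∑ i, |taylorPoly α m (normalizedEigenvalues hG.isHermitian i)|)) :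
    |renyiEntropy hG.isHermitian α - taylorEstimate hG.isHermitian α m g| ≤
      |1 / (1 - α) * logb 2 (1 - 3 * ε)| := by
  obtain ⟨hlo, hhi⟩ := sum_taylorPoly_normalizedEigenvalues_bounds hG hG0 hα hε hε3 hm
  have hT := one_le_sum_normalizedEigenvalues_rpow hG hG0 α
  have hL : 0 < lambdaMax hG.isHermitian ^ α := rpow_pos_of_pos (lambdaMax_pos hG hG0) α
  rw [renyiEntropy_eq hG hG0, taylorEstimate_eq, ← mul_sub, abs_mul, abs_mul]
  set T := ∑ i, normalizedEigenvalues hG.isHermitian i ^ α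
  set P := ∑ i, taylorPoly α m (normalizedEigenvalues hG.isHermitian i)
  set B := ∑ i, |taylorPoly α m (normalizedEigenvalues hG.isHermitian i)|
  set Z := ∑ j, diagonalForm hG.isHermitian.eigenvectorBasis
    (fun i => taylorPoly α m (normalizedEigenvalues hG.isHermitian i)) (g j)
  have hs' : (0 : ℝ) < s := Nat.cast_pos.2 hs
  obtain ⟨hZlo, hZhi⟩ := abs_le.1 hg
  have hmean_lo : (1 - 3 * ε) * T ≤ Z / s := by
    refine hlo.trans ((le_div_iff₀' hs').2 ?_)
    linarith
  have hmean_hi : Z / s ≤ T / (1 - 3 * ε) := by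
    refine ((div_le_iff₀' hs').2 ?_).trans hhi
    linarith
  refine mul_le_mul_of_nonneg_left (abs_logb_sub_logb_le one_lt_two (by linarith)
    (mul_pos hL (by linarith)) ?_ ?_) (abs_nonneg _)
  · rw [mul_left_comm]
    exact mul_le_mul_of_nonneg_left hmean_lo hL.le
  · rw [mul_div_assoc]
    exact mul_le_mul_of_nonneg_left hmean_hi hL.le

end PosSemidef

/-! ### Normalized kernel matrices -/

section Kernel

variable {X : Type*} {φ : X → X → ℝ} {x : Fin n → X}

theorem kernelMatrix_posSemidef (hφ : IsPositiveKernel φ) (hx : ∀ i, 0 < φ (x i) (x i)) :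
    (kernelMatrix φ x).PosSemidef := by
  set d : Fin n → ℝ := fun i => (√(φ (x i) (x i)))⁻¹
  have h := ((hφ n x).mul_mul_conjTranspose_same (diagonal d)).smul
    (show (0 : ℝ) ≤ 1 / n by positivity)
  convert h using 1
  ext i j
  rw [Matrix.smul_apply, diagonal_conjTranspose, mul_diagonal, diagonal_mul]
  simp only [kernelMatrix, of_apply, smul_eq_mul, d, Pi.star_apply, star_trivial]
  rw [sqrt_mul (hx i).le]
  field_simp

theorem kernelMatrix_ne_zero (hn : 0 < n) (hx : ∀ i, 0 < φ (x i) (x i)) :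
    kernelMatrix φ x ≠ 0 := by
  intro h
  have hentry : kernelMatrix φ x ⟨0, hn⟩ ⟨0, hn⟩ = 1 / n := by
    rw [kernelMatrix, of_apply, sqrt_mul_self (hx _).le, div_self (hx _).ne', mul_one]
  rw [h, Matrix.zero_apply] at hentry
  exact (one_div_pos.2 (Nat.cast_pos.2 hn) : (0 : ℝ) < 1 / n).ne hentry

end Kernel

end RenyiTaylor

end

theorem theorem2_general {n : ℕ} {G : Matrix (Fin n) (Fin n) ℝ} (hG : G.PosSemidef) (hG0 : G ≠ 0)
    (α : ℝ) (hα : 0 < α) (hα1 : α ≠ 1)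
    (ε : ℝ) (hε : 0 < ε) (hε3 : ε < 1 / 3)
    (δ : ℝ) (hδ : 0 < δ) (hδ1 : δ < 1)
    {m : ℕ} (hm : RenyiTaylor.taylorDegree hG.isHermitian α ε ≤ m)
    {s : ℕ} (hs : RenyiTaylor.sampleSize δ ε ≤ s)
    {Ω : Type*} [MeasurableSpace Ω] (μ : Measure Ω) [IsProbabilityMeasure μ]
    (g : Fin s → Ω → EuclideanSpace ℝ (Fin n))
    (hg : ∀ i, HasLaw (g i) (stdGaussian (EuclideanSpace ℝ (Fin n))) μ)
    (hind : iIndepFun g μ) :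
    1 - δ ≤ μ.real {ω |
      |RenyiTaylor.renyiEntropy hG.isHermitian α -
        RenyiTaylor.taylorEstimate hG.isHermitian α m (fun i => g i ω)| ≤
        |1 / (1 - α) * Real.logb 2 (1 - 3 * ε)|} := by
  set p : Fin n → ℝ := fun i =>
    RenyiTaylor.taylorPoly α m (RenyiTaylor.normalizedEigenvalues hG.isHermitian i)
  have hpB : ∑ i, p i ^ 2 ≤ (∑ i, |p i|) ^ 2 := by
    simpa only [sq_abs] using
      Finset.sum_sq_le_sq_sum_of_nonneg fun i (_ : i ∈ Finset.univ) => abs_nonneg (p i)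
  have hconc := RenyiTaylor.one_sub_two_mul_exp_le_measureReal_abs_sum_diagonalForm_sub_le hg hind
    hG.isHermitian.eigenvectorBasis
    (RenyiTaylor.sum_abs_taylorPoly_normalizedEigenvalues_pos hG hG0 hα hε hε3 hm) hpB hε.le
    (by linarith)
  rw [Fintype.card_fin] at hconc
  have hexp := RenyiTaylor.exp_neg_le_of_sampleSize_le hδ hε hs
  have hs0 : 0 < s := (RenyiTaylor.sampleSize_pos hδ (by linarith) hε).trans_le hs
  calc 1 - δ ≤ 1 - 2 * Real.exp (-(s * ε ^ 2 / 8)) := by linarith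
    _ ≤ _ := hconc
    _ ≤ _ := measureReal_mono fun ω hω =>
      RenyiTaylor.abs_renyiEntropy_sub_taylorEstimate_le hG hG0 hα hε hε3 hm hs0 hω

theorem theorem2 {X : Type*} (φ : X → X → ℝ) (hφ : RenyiTaylor.IsPositiveKernel φ)
    {n : ℕ} (hn : 0 < n) (x : Fin n → X) (hx : ∀ i, 0 < φ (x i) (x i))
    (α : ℝ) (hα : 0 < α) (hα1 : α ≠ 1)
    (ε : ℝ) (hε : 0 < ε) (hε3 : ε < 1 / 3)
    (δ : ℝ) (hδ : 0 < δ) (hδ1 : δ < 1)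
    {Ω : Type*} [MeasurableSpace Ω] (μ : Measure Ω) [IsProbabilityMeasure μ]
    (g : Fin (RenyiTaylor.sampleSize δ ε) → Ω → EuclideanSpace ℝ (Fin n))
    (hg : ∀ i, HasLaw (g i) (stdGaussian (EuclideanSpace ℝ (Fin n))) μ)
    (hind : iIndepFun g μ) :
    1 - δ ≤ μ.real {ω |
      |RenyiTaylor.renyiEntropy (RenyiTaylor.kernelMatrix_isHermitian hφ x) α -
        RenyiTaylor.taylorEstimate (RenyiTaylor.kernelMatrix_isHermitian hφ x) α
          (RenyiTaylor.taylorDegree (RenyiTaylor.kernelMatrix_isHermitian hφ x) α ε)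
          (fun i => g i ω)| ≤
        |1 / (1 - α) * Real.logb 2 (1 - 3 * ε)|} :=
  theorem2_general (RenyiTaylor.kernelMatrix_posSemidef hφ hx)
    (RenyiTaylor.kernelMatrix_ne_zero hn hx) α hα hα1 ε hε hε3 δ hδ hδ1 le_rfl le_rfl μ g hg hind
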